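/- **Setting.** Let $\theta_0\in\mathbb R$, $r_*>0$, and let $r_1,r_2$ be positive continuous functions on $[\theta_0,\infty)$ with $r_2(\theta+2\pi)<r_1(\theta)<r_2(\theta)$ for all $\theta\ge\theta_0$ and $\lim_{\theta\to\infty}r_1(\theta)=\lim_{\theta\to\infty}r_2(\theta)=r_*$. With $X(r,\theta)=(r\cos\theta,r\sin\theta)$ put $$U=\{X(r,\theta):\theta>\theta_0,\ r_1(\theta)<r<r_2(\theta)\},\qquad \widetilde U=\{X(r,\theta):\theta\ge\theta_0,\ r_1(\theta)\le r\le r_2(\theta)\},$$ $$\mathcal S_\theta=\{X(r,\theta):r_1(\theta)\le r\le r_2(\theta)\},\qquad \gamma=\{X(r_i(\theta),\theta):\theta\ge\theta_0,\ i=1,2\}.$$ Let $c_0,M_1>0$. We consider operators $$Lu=-\sum_{i,j=1}^2a_{ij}\frac{\partial^2u}{\partial x_i\partial x_j}+b\cdot\nabla u,$$ where $A=(a_{ij})$ is a function from $U$ to the real symmetric $2\times2$ matrices with $\xi^{\rm T}A(x)\xi\ge c_0|\xi|^2$ and $\operatorname{Tr}A(x)\le M_1$ for all $x\in U$, $\xi\in\mathbb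 R^2$, and $b:U\to\mathbb R^2$. Let $u_1,u_2\in C^2(U)\cap C(\widetilde U)$. A function $u\in C(\widetilde U)$ is *below exponential growth* in $\widetilde U$ if $\lim_{\theta\to\infty}e^{-\varepsilon\theta}\max_{\mathcal S_\theta}|u|=0$ for every $\varepsilon>0$. **Theorem.** (i) Let $M_2\ge0$. There are constants $C_*>0$ and $\nu>0$, depending only on $\theta_0,r_1,r_2,r_*,c_0,M_1,M_2$, such that the following holds for all $A$, $b$ as above with $|b(x)|\le M_2$ for all $x\in U$. If $Lu_1=Lu_2$ in $U$, $u_1=u_2$ on $\gamma$, and $u_1,u_2$ are below exponential growth in $\widetilde U$, then $u_1-u_2$ is bounded on $U$, $$\sup_{x\in U}|u_1(x)-u_2(x)|\le\max_{x\in\mathcal S_{\theta_0}}|u_1(x)-u_2(x)|,$$ $$\max_{x\in\mathcal S_\theta}|u_1(x)-u_2(x)|\le C_*\Big(\max_{x\in\mathcal S_{\theta_0}}|u_1(x)-u_2(x)|\Big)e^{-\nu(\theta-\theta_0)}\quad\text{for all }\theta\ge\theta_0.$$ (ii) Let $\bar\Theta\ge\theta_0$, let $m:[\bar\Theta,\infty)\to[0,\infty)$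 be nondecreasing with $\lim_{\theta\to\infty}m(\theta)=\infty$, and let $\kappa\in(0,1)$ with $\int_{\bar\Theta}^\infty\kappa^{m(\theta)}\,d\theta=\infty$. There are numbers $\Theta_0\ge\bar\Theta$ and $\bar\nu>0$, depending only on $\theta_0,r_1,r_2,r_*,c_0,M_1,\bar\Theta,m,\kappa$, such that the following holds for all $A$, $b$ as above for which $b$ is bounded on the part of $U$ with angles in $[\theta_0,\bar\Theta]$, and $|b(x)|\le m(\theta)$ for all $\theta\ge\bar\Theta$ and $x\in U\cap\mathcal S_\theta$. If $Lu_1=Lu_2$ in $U$, $u_1=u_2$ on $\gamma$, and $u_1,u_2$ are bounded in $\widetilde U$, then for all $\theta\ge\theta_0$ $$\max_{x\in\mathcal S_\theta}|u_1(x)-u_2(x)|\le\Big(\max_{x\in\mathcal S_{\theta_0}}|u_1(x)-u_2(x)|\Big)\min\Big\{1,\exp\Big(-\bar\nu\int_{\Theta_0}^\theta\kappa^{m(\zeta)}\,d\zeta\Big)\Big\},$$ where for $\theta<\Theta_0$ the minimum is understood to be $1$. -/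

import Mathlib

open Filter Topology

noncomputable section

namespace Spiral

/-- The Euclidean plane. -/
abbrev Plane : Type := EuclideanSpace ℝ (Fin 2)

/-- Polar coordinates: `X(r, θ) = (r cos θ, r sin θ)`. -/
def polar (r θ : ℝ) : Plane := !₂[r * Real.cos θ, r * Real.sin θ]

/-- The standing assumptions on the two boundary functions. Only their values on `[θ₀, ∞)`
are constrained. -/
structure IsProfile (θ₀ : ℝ) (r₁ r₂ : ℝ → ℝ) (rlim : ℝ) : Prop where
  continuousOn_left : ContinuousOn r₁ (Set.Ici θ₀)
  continuousOn_right : ContinuousOn r₂ (Set.Ici θ₀)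
  pos_left : ∀ θ, θ₀ ≤ θ → 0 < r₁ θ
  pos_right : ∀ θ, θ₀ ≤ θ → 0 < r₂ θ
  next_turn_lt : ∀ θ, θ₀ ≤ θ → r₂ (θ + 2 * Real.pi) < r₁ θ
  lt : ∀ θ, θ₀ ≤ θ → r₁ θ < r₂ θ
  rlim_pos : 0 < rlim
  tendsto_left : Tendsto r₁ atTop (𝓝 rlim)
  tendsto_right : Tendsto r₂ atTop (𝓝 rlim)

/-- The open winding domain `U`. -/
def domU (θ₀ : ℝ) (r₁ r₂ : ℝ → ℝ) : Set Plane :=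
  {x | ∃ θ r, θ₀ < θ ∧ r₁ θ < r ∧ r < r₂ θ ∧ x = polar r θ}

/-- The set `Ũ`: the domain together with its two boundary curves and its initial cross-section
(the limiting circle is not included). -/
def domUt (θ₀ : ℝ) (r₁ r₂ : ℝ → ℝ) : Set Plane :=
  {x | ∃ θ r, θ₀ ≤ θ ∧ r₁ θ ≤ r ∧ r ≤ r₂ θ ∧ x = polar r θ}

/-- The lateral boundary `γ = γ₁ ∪ γ₂`. -/
def lateral (θ₀ : ℝ) (r₁ r₂ : ℝ → ℝ) : Set Plane :=
  {x | ∃ θ, θ₀ ≤ θ ∧ x = polar (r₁ θ) θ} ∪ {x | ∃ θ, θ₀ ≤ θ ∧ x = polar (r₂ θ) θ}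

/-- The cross-section `S_θ`. -/
def crossSec (r₁ r₂ : ℝ → ℝ) (θ : ℝ) : Set Plane :=
  {x | ∃ r, r₁ θ ≤ r ∧ r ≤ r₂ θ ∧ x = polar r θ}

/-- The portion `U_I` of the domain with angle in `I`. -/
def portion (r₁ r₂ : ℝ → ℝ) (I : Set ℝ) : Set Plane :=
  {x | ∃ θ r, θ ∈ I ∧ r₁ θ < r ∧ r < r₂ θ ∧ x = polar r θ}

/-- The supremum of `|f|` over `S`. On the cross-sections, for `f` continuous on `Ũ`, it is a
maximum, see `isGreatest_supAbs` below. -/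
def supAbs (f : Plane → ℝ) (S : Set Plane) : ℝ := sSup ((fun x => |f x|) '' S)

/-- The partial derivative of `f` in the `i`-th coordinate. -/
def pderiv (i : Fin 2) (f : Plane → ℝ) (x : Plane) : ℝ :=
  fderiv ℝ f x (EuclideanSpace.single i 1)

/-- `L u = - ∑ aᵢⱼ ∂ᵢ∂ⱼ u + b · ∇u`. -/
def opL (A : Plane → Matrix (Fin 2) (Fin 2) ℝ) (b : Plane → Plane) (u : Plane → ℝ)
    (x : Plane) : ℝ :=
  -(∑ i, ∑ j, A x i j * pderiv i (pderiv j u) x) + ∑ i, b x i * pderiv i u x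

/-- Symmetry, uniform ellipticity and the bound on the trace of the coefficient matrix. -/
structure IsElliptic (Ω : Set Plane) (A : Plane → Matrix (Fin 2) (Fin 2) ℝ) (c₀ M₁ : ℝ) :
    Prop where
  symm : ∀ x ∈ Ω, (A x).IsSymm
  lower : ∀ x ∈ Ω, ∀ ξ : Plane, c₀ * ‖ξ‖ ^ 2 ≤ ∑ i, ∑ j, ξ i * A x i j * ξ j
  trace_le : ∀ x ∈ Ω, (A x).trace ≤ M₁

/-- The class `C²(U) ∩ C(Ũ)`. -/
def IsRegular (θ₀ : ℝ) (r₁ r₂ : ℝ → ℝ) (u : Plane → ℝ) : Prop :=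
  ContDiffOn ℝ 2 u (domU θ₀ r₁ r₂) ∧ ContinuousOn u (domUt θ₀ r₁ r₂)

/-- `u` is below exponential growth in `Ũ`. -/
def BelowExpGrowth (θ₀ : ℝ) (r₁ r₂ : ℝ → ℝ) (u : Plane → ℝ) : Prop :=
  ∀ ε : ℝ, 0 < ε →
    Tendsto (fun θ => Real.exp (-ε * θ) * supAbs u (crossSec r₁ r₂ θ ∩ domUt θ₀ r₁ r₂))
      atTop (𝓝 0)

/-- The rate function `m` of an unbounded drift, together with the number `κ`. Only the values of
`m` on `[Θ, ∞)` are constrained; there `κ ^ m` is monotone, hence locally integrable. -/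
structure IsRate (θ₀ Θ : ℝ) (m : ℝ → ℝ) (κ : ℝ) : Prop where
  le_start : θ₀ ≤ Θ
  nonneg : ∀ θ, Θ ≤ θ → 0 ≤ m θ
  mono : MonotoneOn m (Set.Ici Θ)
  tendsto : Tendsto m atTop atTop
  kappa_pos : 0 < κ
  kappa_lt_one : κ < 1
  integral_eq_top : Tendsto (fun T => ∫ ζ in Θ..T, κ ^ m ζ) atTop atTop

/-- The drift is bounded in the part of `U` with angles in `[θ₀, Θ]` and bounded by `m(θ)` on the
part of `U` in the cross-section `S_θ` for `θ ≥ Θ`. -/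
structure DriftLe (θ₀ : ℝ) (r₁ r₂ : ℝ → ℝ) (Θ : ℝ) (m : ℝ → ℝ) (b : Plane → Plane) : Prop where
  bounded_start : ∃ B : ℝ, ∀ x ∈ domU θ₀ r₁ r₂ ∩ portion r₁ r₂ (Set.Icc θ₀ Θ), ‖b x‖ ≤ B
  le_rate : ∀ θ, Θ ≤ θ → ∀ x ∈ domU θ₀ r₁ r₂ ∩ crossSec r₁ r₂ θ, ‖b x‖ ≤ m θ

/-- On a cross-section the supremum of `|f|` is attained. -/
theorem isGreatest_supAbs {θ₀ : ℝ} {r₁ r₂ : ℝ → ℝ} {rlim : ℝ} (h : IsProfile θ₀ r₁ r₂ rlim)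
    {f : Plane → ℝ} (hf : ContinuousOn f (domUt θ₀ r₁ r₂)) {θ : ℝ} (hθ : θ₀ ≤ θ) :
    IsGreatest ((fun x => |f x|) '' crossSec r₁ r₂ θ) (supAbs f (crossSec r₁ r₂ θ)) := by
  have hS : crossSec r₁ r₂ θ = (fun r => polar r θ) '' Set.Icc (r₁ θ) (r₂ θ) := by
    ext x
    constructor
    · rintro ⟨r, h1, h2, rfl⟩
      exact ⟨r, ⟨h1, h2⟩, rfl⟩
    · rintro ⟨r, ⟨h1, h2⟩, rfl⟩
      exact ⟨r, h1, h2, rfl⟩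
  have hc : Continuous (fun r => polar r θ) := by
    unfold polar
    refine (PiLp.continuous_toLp 2 _).comp (continuous_pi fun i => ?_)
    fin_cases i <;> simp <;> fun_prop
  have hK : IsCompact (crossSec r₁ r₂ θ) := hS ▸ isCompact_Icc.image hc
  have hsub : crossSec r₁ r₂ θ ⊆ domUt θ₀ r₁ r₂ := by
    rintro x ⟨r, h1, h2, rfl⟩
    exact ⟨θ, r, hθ, h1, h2, rfl⟩
  have hne : (crossSec r₁ r₂ θ).Nonempty := ⟨_, r₁ θ, le_rfl, (h.lt θ hθ).le, rfl⟩
  exact (hK.image_of_continuousOn (hf.mono hsub).abs).isGreatest_sSup (hne.image _)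

end Spiral

end

noncomputable section

namespace Spiral

variable {θ₀ : ℝ} {r₁ r₂ : ℝ → ℝ} {rlim : ℝ}

/-! The difference `w` of the two solutions satisfies `L w = 0` and vanishes on the lateral
boundary. Its decay comes from comparison with one explicit barrier, `exp (α ⟨e, x⟩)` with `‖e‖ =
1`: by `opL_exp_inner`, `L` of it is negative as soon as `α c₀` exceeds the bound of the drift, so
`w` plus a positive multiple of it has no interior local maximum (`IsNullSolution.add_barrier_le`).
A small multiple gives the maximum principle on slabs.

A large multiple gives contraction. Far out the spiral is a thin layer outside the limit circle.
With `e` pointing towards angle `a`, the barrier is larger on `S_a` than on `S_{a-1}` and `S_{a+1}`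
because the circle curves away, and on the lateral boundary the vanishing of `w` leaves room for it.
Hence the maximum `M` of `|w|` satisfies `M a ≤ (1 - d) * max (M (a - 1)) (M (a + 1))`
(`IsNullSolution.supAbs_le_mul_max`).

Along an arithmetic progression such a recursion leaves two possibilities: steady decay, or growth
from some index on at least like `exp (∑ d)` (`succ_le_of_succ_le_max`). The growth hypothesis
excludes the second. For bounded drift `d` is constant; for drift at most `m` it can be taken as a
multiple of `κ ^ m`, whose sums diverge with the integral. -/

/-! ### Linearity of the operator and its action on exponentials -/

theorem pderiv_add {f g : Plane → ℝ} {x : Plane} (i : Fin 2) (hf : DifferentiableAt ℝ f x)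
    (hg : DifferentiableAt ℝ g x) : pderiv i (f + g) x = pderiv i f x + pderiv i g x := by
  simp [pderiv, fderiv_add hf hg]

theorem pderiv_const_smul (c : ℝ) {f : Plane → ℝ} {x : Plane} (i : Fin 2)
    (hf : DifferentiableAt ℝ f x) : pderiv i (c • f) x = c * pderiv i f x := by
  simp [pderiv, fderiv_const_smul hf c]

theorem differentiableAt_pderiv {f : Plane → ℝ} {x : Plane} (hf : ContDiffAt ℝ 2 f x)
    (i : Fin 2) : DifferentiableAt ℝ (pderiv i f) x :=
  ((hf.fderiv_right (m := 1) (by norm_num)).differentiableAt one_ne_zero).clm_apply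
    (differentiableAt_const _)

theorem eventually_differentiableAt {f : Plane → ℝ} {x : Plane} (hf : ContDiffAt ℝ 2 f x) :
    ∀ᶠ y in 𝓝 x, DifferentiableAt ℝ f y := by
  filter_upwards [hf.eventually (by simp)] with y hy
  exact hy.differentiableAt two_ne_zero

theorem pderiv_congr {f g : Plane → ℝ} {x : Plane} (i : Fin 2) (h : f =ᶠ[𝓝 x] g) :
    pderiv i f x = pderiv i g x := by
  simp [pderiv, h.fderiv_eq]

theorem opL_add (A : Plane → Matrix (Fin 2) (Fin 2) ℝ) (b : Plane → Plane) {f g : Plane → ℝ}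
    {x : Plane} (hf : ContDiffAt ℝ 2 f x) (hg : ContDiffAt ℝ 2 g x) :
    opL A b (f + g) x = opL A b f x + opL A b g x := by
  have h2 : ∀ i j, pderiv i (pderiv j (f + g)) x
      = pderiv i (pderiv j f) x + pderiv i (pderiv j g) x := by
    intro i j
    rw [← pderiv_add i (differentiableAt_pderiv hf j) (differentiableAt_pderiv hg j)]
    apply pderiv_congr
    filter_upwards [eventually_differentiableAt hf, eventually_differentiableAt hg] with y h1 h2
    exact pderiv_add j h1 h2
  simp only [opL, h2, pderiv_add _ (hf.differentiableAt two_ne_zero)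
    (hg.differentiableAt two_ne_zero), Fin.sum_univ_two]
  ring

theorem opL_const_smul (A : Plane → Matrix (Fin 2) (Fin 2) ℝ) (b : Plane → Plane) (c : ℝ)
    {f : Plane → ℝ} {x : Plane} (hf : ContDiffAt ℝ 2 f x) :
    opL A b (c • f) x = c * opL A b f x := by
  have h2 : ∀ i j, pderiv i (pderiv j (c • f)) x = c * pderiv i (pderiv j f) x := by
    intro i j
    rw [← pderiv_const_smul c i (differentiableAt_pderiv hf j)]
    apply pderiv_congr
    filter_upwards [eventually_differentiableAt hf] with y h1
    exact pderiv_const_smul c j h1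
  simp only [opL, h2, pderiv_const_smul c _ (hf.differentiableAt two_ne_zero), Fin.sum_univ_two]
  ring

theorem contDiff_exp_inner (α : ℝ) (e : Plane) :
    ContDiff ℝ 2 (fun x : Plane => Real.exp (α * inner ℝ e x)) :=
  (contDiff_const.mul (innerSL ℝ e).contDiff).exp

theorem pderiv_exp_inner (α : ℝ) (e : Plane) (i : Fin 2) (x : Plane) :
    pderiv i (fun x : Plane => Real.exp (α * inner ℝ e x)) x
      = α * e i * Real.exp (α * inner ℝ e x) := by
  have h := (((innerSL ℝ e).hasFDerivAt (x := x)).const_mul α).exp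
  have h' : fderiv ℝ (fun x : Plane => Real.exp (α * inner ℝ e x)) x = _ := h.fderiv
  rw [pderiv, h']
  simp [EuclideanSpace.inner_single_right]
  ring

/-- By ellipticity the quadratic form is at least `c₀` for a unit vector `e`, so for large `α` it
dominates the drift term and the right side is negative. -/
theorem opL_exp_inner (A : Plane → Matrix (Fin 2) (Fin 2) ℝ) (b : Plane → Plane) (α : ℝ)
    (e x : Plane) :
    opL A b (fun x => Real.exp (α * inner ℝ e x)) x
      = α * Real.exp (α * inner ℝ e x)
        * (inner ℝ (b x) e - α * ∑ i, ∑ j, e i * A x i j * e j) := by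
  have h1 : ∀ j, pderiv j (fun x : Plane => Real.exp (α * inner ℝ e x))
      = (α * e j) • fun x : Plane => Real.exp (α * inner ℝ e x) := by
    intro j
    ext y
    simp [pderiv_exp_inner]
  have h2 : ∀ i j, pderiv i (pderiv j (fun x : Plane => Real.exp (α * inner ℝ e x))) x
      = α * e j * (α * e i * Real.exp (α * inner ℝ e x)) := by
    intro i j
    rw [h1, pderiv_const_smul _ _ ((contDiff_exp_inner α e).contDiffAt.differentiableAt
      two_ne_zero), pderiv_exp_inner]
  have hb : inner ℝ (b x) e = b x 0 * e 0 + b x 1 * e 1 := by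
    simp [PiLp.inner_apply, Fin.sum_univ_two]
    ring
  simp only [opL, h2, pderiv_exp_inner, Fin.sum_univ_two, hb]
  ring

/-! ### Second order conditions at a local maximum -/

/-- The second order necessary condition for a local maximum on the line. -/
theorem deriv_deriv_nonpos_of_isLocalMax {g : ℝ → ℝ} {t : ℝ} (hg : ContinuousAt g t)
    (hmax : IsLocalMax g t) : deriv (deriv g) t ≤ 0 := by
  by_contra! h
  -- A positive second derivative would make `t` a local minimum too; then `g` is locally constant
  -- and its second derivative vanishes.
  have hmin := isLocalMin_of_deriv_deriv_pos h hmax.deriv_eq_zero hg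
  have hconst : g =ᶠ[𝓝 t] fun _ => g t := by
    filter_upwards [hmin, hmax] with y h1 h2 using le_antisymm h2 h1
  have : deriv g =ᶠ[𝓝 t] deriv fun _ => g t := hconst.deriv
  rw [this.deriv_eq] at h
  simp at h

theorem fderiv_eq_sum_pderiv (f : Plane → ℝ) (x ξ : Plane) :
    fderiv ℝ f x ξ = ∑ i, ξ i * pderiv i f x := by
  have : ξ = ∑ i, ξ i • EuclideanSpace.single i (1 : ℝ) := by
    ext k
    fin_cases k <;> simp
  conv_lhs => rw [this]
  simp [pderiv]

theorem sum_second_pderiv_nonpos_of_isLocalMax {f : Plane → ℝ} {x : Plane}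
    (hf : ContDiffAt ℝ 2 f x) (hmax : IsLocalMax f x) (ξ : Plane) :
    ∑ i, ∑ j, ξ i * ξ j * pderiv i (pderiv j f) x ≤ 0 := by
  have hline : ∀ t : ℝ, HasDerivAt (fun t : ℝ => x + t • ξ) ξ t := by
    intro t
    simpa using ((hasDerivAt_id t).smul_const ξ).const_add x
  have hcont : Tendsto (fun t : ℝ => x + t • ξ) (𝓝 0) (𝓝 x) := by
    simpa using (hline 0).continuousAt.tendsto
  have h1 : deriv (fun t : ℝ => f (x + t • ξ))
      =ᶠ[𝓝 0] fun t => ∑ j, ξ j * pderiv j f (x + t • ξ) := by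
    filter_upwards [hcont.eventually (eventually_differentiableAt hf)] with t ht
    rw [← fderiv_eq_sum_pderiv]
    exact (ht.hasFDerivAt.comp_hasDerivAt t (hline t)).deriv
  have h2 : HasDerivAt (fun t : ℝ => ∑ j, ξ j * pderiv j f (x + t • ξ))
      (∑ j, ξ j * ∑ i, ξ i * pderiv i (pderiv j f) x) 0 := by
    refine HasDerivAt.fun_sum fun j _ => HasDerivAt.const_mul _ ?_
    rw [← fderiv_eq_sum_pderiv]
    have hd : HasFDerivAt (pderiv j f) (fderiv ℝ (pderiv j f) x) (x + (0 : ℝ) • ξ) := by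
      simpa using (differentiableAt_pderiv hf j).hasFDerivAt
    exact hd.comp_hasDerivAt 0 (hline 0)
  have hm : IsLocalMax (fun t : ℝ => f (x + t • ξ)) 0 := by
    have := hcont.eventually hmax
    simpa [IsLocalMax, IsMaxFilter] using this
  have hc : ContinuousAt (fun t : ℝ => f (x + t • ξ)) 0 := by
    have : Tendsto f (𝓝 x) (𝓝 (f x)) := hf.continuousAt
    simpa [ContinuousAt, Function.comp_def] using this.comp hcont
  have h3 := deriv_deriv_nonpos_of_isLocalMax hc hm
  rw [h1.deriv_eq, h2.deriv] at h3
  simp only [Fin.sum_univ_two] at h3 ⊢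
  linarith

theorem opL_nonneg_of_isLocalMax {Ω : Set Plane} {A : Plane → Matrix (Fin 2) (Fin 2) ℝ}
    {c₀ M₁ : ℝ} (hA : IsElliptic Ω A c₀ M₁) (hc₀ : 0 < c₀) (b : Plane → Plane) {f : Plane → ℝ}
    {x : Plane} (hx : x ∈ Ω) (hf : ContDiffAt ℝ 2 f x) (hmax : IsLocalMax f x) :
    0 ≤ opL A b f x := by
  have hgrad : ∀ i, pderiv i f x = 0 := fun i => by simp [pderiv, hmax.fderiv_eq_zero]
  have hs : A x 1 0 = A x 0 1 := (hA.symm x hx).apply 0 1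
  have ha : 0 < A x 0 0 := by
    have := hA.lower x hx !₂[1, 0]
    simp [EuclideanSpace.norm_sq_eq] at this
    linarith
  have hdet : 0 ≤ A x 0 0 * A x 1 1 - A x 0 1 ^ 2 := by
    -- On this vector the quadratic form equals `A x 0 0` times the determinant.
    have := hA.lower x hx !₂[-A x 0 1, A x 0 0]
    simp [EuclideanSpace.norm_sq_eq, hs] at this
    have h0 : 0 ≤ c₀ * (A x 0 1 ^ 2 + A x 0 0 ^ 2) := by positivity
    have h1 : 0 ≤ A x 0 0 * (A x 0 0 * A x 1 1 - A x 0 1 ^ 2) := by nlinarith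
    exact nonneg_of_mul_nonneg_right h1 ha
  have e1 := sum_second_pderiv_nonpos_of_isLocalMax hf hmax !₂[A x 0 0, A x 0 1]
  have e2 := sum_second_pderiv_nonpos_of_isLocalMax hf hmax !₂[0, 1]
  simp [Fin.sum_univ_two] at e1 e2
  simp only [opL, hgrad, Fin.sum_univ_two, hs]
  -- Completing the square: `A x 0 0` times the second order term is the second derivative along the
  -- first row of `A x` plus the determinant times `∂₁∂₁ f`. This replaces a diagonalisation.
  have key : A x 0 0 * (A x 0 0 * pderiv 0 (pderiv 0 f) x + A x 0 1 * pderiv 0 (pderiv 1 f) x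
      + (A x 0 1 * pderiv 1 (pderiv 0 f) x + A x 1 1 * pderiv 1 (pderiv 1 f) x)) ≤ 0 := by
    nlinarith [mul_nonpos_of_nonneg_of_nonpos hdet e2]
  have := nonpos_of_mul_nonpos_right key ha
  linarith

/-! ### Polar coordinates and the geometry of the spiral -/

theorem continuous_polar : Continuous fun p : ℝ × ℝ => polar p.1 p.2 := by
  unfold polar
  refine (PiLp.continuous_toLp 2 _).comp (continuous_pi fun i => ?_)
  fin_cases i <;> simp <;> fun_prop

theorem inner_polar (r s θ φ : ℝ) : inner ℝ (polar r θ) (polar s φ) = r * s * Real.cos (φ - θ) := by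
  simp [polar, PiLp.inner_apply, Fin.sum_univ_two, Real.cos_sub]
  ring

theorem norm_polar_one (θ : ℝ) : ‖polar 1 θ‖ = 1 := by
  rw [← sq_eq_sq₀ (norm_nonneg _) zero_le_one, ← real_inner_self_eq_norm_sq, inner_polar]
  simp

/-- In polar coordinates, small perturbations of the coordinates of `polar r θ`, `r > 0`, cover a
neighbourhood of this point. -/
theorem eventually_exists_polar {r θ : ℝ} (hr : 0 < r) {p : ℝ → ℝ → Prop}
    (hp : ∀ᶠ q : ℝ × ℝ in 𝓝 (r, θ), p q.1 q.2) :
    ∀ᶠ x in 𝓝 (polar r θ), ∃ r' θ', p r' θ' ∧ x = polar r' θ' := by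
  -- In logarithmic polar coordinates the map is the complex exponential, which is open at each
  -- point because its derivative never vanishes.
  let Φ := Complex.orthonormalBasisOneI.repr
  have hΦ : ∀ z : ℂ, Φ (Complex.exp z) = polar (Real.exp z.re) z.im := by
    intro z
    ext i
    fin_cases i <;> simp [Φ, polar, Complex.exp_re, Complex.exp_im]
  let z₀ : ℂ := ⟨Real.log r, θ⟩
  have hz₀ : polar r θ = Φ (Complex.exp z₀) := by simp [hΦ, z₀, Real.exp_log hr]
  have hc : Tendsto (fun z : ℂ => (Real.exp z.re, z.im)) (𝓝 z₀) (𝓝 (r, θ)) := by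
    have : Continuous fun z : ℂ => (Real.exp z.re, z.im) := by fun_prop
    simpa [z₀, Real.exp_log hr] using this.tendsto z₀
  have hm : map (fun z : ℂ => Φ (Complex.exp z)) (𝓝 z₀) = 𝓝 (polar r θ) := by
    have hn : map Φ (𝓝 (Complex.exp z₀)) = 𝓝 (Φ (Complex.exp z₀)) :=
      Φ.toHomeomorph.map_nhds_eq _
    rw [hz₀, ← hn, ← (Complex.hasStrictDerivAt_exp z₀).map_nhds_eq (Complex.exp_ne_zero _), map_map]
    rfl
  rw [← hm, eventually_map]
  filter_upwards [hc.eventually hp] with z hz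
  exact ⟨_, _, hz, hΦ z⟩


theorem portion_Ioo_mem_nhds (h : IsProfile θ₀ r₁ r₂ rlim) {s t r θ : ℝ} (hs : θ₀ ≤ s)
    (hsθ : s < θ) (hθt : θ < t) (h1 : r₁ θ < r) (h2 : r < r₂ θ) :
    portion r₁ r₂ (Set.Ioo s t) ∈ 𝓝 (polar r θ) := by
  have hθ : θ₀ < θ := hs.trans_lt hsθ
  have c1 : Tendsto (fun q : ℝ × ℝ => r₁ q.2) (𝓝 (r, θ)) (𝓝 (r₁ θ)) :=
    (h.continuousOn_left.continuousAt (Ici_mem_nhds hθ)).tendsto.comp continuous_snd.continuousAt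
  have c2 : Tendsto (fun q : ℝ × ℝ => r₂ q.2) (𝓝 (r, θ)) (𝓝 (r₂ θ)) :=
    (h.continuousOn_right.continuousAt (Ici_mem_nhds hθ)).tendsto.comp continuous_snd.continuousAt
  have cr : Tendsto (fun q : ℝ × ℝ => q.1) (𝓝 (r, θ)) (𝓝 r) := continuous_fst.continuousAt
  have cθ : Tendsto (fun q : ℝ × ℝ => q.2) (𝓝 (r, θ)) (𝓝 θ) := continuous_snd.continuousAt
  have hp : ∀ᶠ q : ℝ × ℝ in 𝓝 (r, θ),
      q.2 ∈ Set.Ioo s t ∧ r₁ q.2 < q.1 ∧ q.1 < r₂ q.2 :=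
    (cθ.eventually (Ioo_mem_nhds hsθ hθt)).and ((c1.eventually_lt cr h1).and
      (cr.eventually_lt c2 h2))
  filter_upwards [eventually_exists_polar ((h.pos_left θ hθ.le).trans h1)
    (p := fun r θ => θ ∈ Set.Ioo s t ∧ r₁ θ < r ∧ r < r₂ θ) hp] with x hx
  obtain ⟨r', θ', ⟨ha, hb, hc⟩, rfl⟩ := hx
  exact ⟨θ', r', ha, hb, hc, rfl⟩

theorem portion_subset_domU {I : Set ℝ} (hI : I ⊆ Set.Ioi θ₀) :
    portion r₁ r₂ I ⊆ domU θ₀ r₁ r₂ := by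
  rintro x ⟨θ, r, hθ, h1, h2, rfl⟩
  exact ⟨θ, r, hI hθ, h1, h2, rfl⟩

theorem crossSec_subset_domUt {θ : ℝ} (hθ : θ₀ ≤ θ) : crossSec r₁ r₂ θ ⊆ domUt θ₀ r₁ r₂ := by
  rintro x ⟨r, h1, h2, rfl⟩
  exact ⟨θ, r, hθ, h1, h2, rfl⟩

theorem domU_mem_nhds (h : IsProfile θ₀ r₁ r₂ rlim) {x : Plane} (hx : x ∈ domU θ₀ r₁ r₂) :
    domU θ₀ r₁ r₂ ∈ 𝓝 x := by
  obtain ⟨θ, r, hθ, h1, h2, rfl⟩ := hx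
  exact mem_of_superset (portion_Ioo_mem_nhds h le_rfl hθ (lt_add_one θ) h1 h2)
    (portion_subset_domU Set.Ioo_subset_Ioi_self)

/-- The inner boundary curve stays outside the limit circle. -/
theorem IsProfile.rlim_le_left (h : IsProfile θ₀ r₁ r₂ rlim) {θ : ℝ} (hθ : θ₀ ≤ θ) :
    rlim ≤ r₁ θ := by
  have hpi := Real.pi_pos
  -- Since `r₂ (θ + 2π) < r₁ θ`, the inner radius decreases from turn to turn, so it is bounded
  -- below by its limit.
  have hstep : ∀ n : ℕ, r₁ (θ + n * (2 * Real.pi)) ≤ r₁ θ := by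
    intro n
    induction n with
    | zero => simp
    | succ n ih =>
      have hn : θ₀ ≤ θ + n * (2 * Real.pi) := by
        have : 0 ≤ n * (2 * Real.pi) := by positivity
        linarith
      have e : θ + (n + 1 : ℕ) * (2 * Real.pi) = θ + n * (2 * Real.pi) + 2 * Real.pi := by
        push_cast
        ring
      rw [e]
      have := h.next_turn_lt _ hn
      have := h.lt (θ + n * (2 * Real.pi) + 2 * Real.pi) (by linarith)
      linarith
  have ht : Tendsto (fun n : ℕ => θ + n * (2 * Real.pi)) atTop atTop :=
    tendsto_atTop_add_const_left _ _
      (tendsto_natCast_atTop_atTop.atTop_mul_const (by positivity))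
  exact le_of_tendsto (h.tendsto_left.comp ht) (Eventually.of_forall hstep)

/-- The closed part of `Ũ` with angles in `[s, t]`. -/
def slab (r₁ r₂ : ℝ → ℝ) (s t : ℝ) : Set Plane :=
  {x | ∃ θ r, s ≤ θ ∧ θ ≤ t ∧ r₁ θ ≤ r ∧ r ≤ r₂ θ ∧ x = polar r θ}

theorem slab_subset_domUt {s t : ℝ} (hs : θ₀ ≤ s) : slab r₁ r₂ s t ⊆ domUt θ₀ r₁ r₂ := by
  rintro x ⟨θ, r, h1, -, h3, h4, rfl⟩
  exact ⟨θ, r, hs.trans h1, h3, h4, rfl⟩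

/-- Affine interpolation between the two radii presents the slab as a continuous image of a
rectangle. -/
theorem isCompact_slab (h : IsProfile θ₀ r₁ r₂ rlim) {s t : ℝ} (hs : θ₀ ≤ s) :
    IsCompact (slab r₁ r₂ s t) := by
  have hsub : Set.Icc s t ⊆ Set.Ici θ₀ := fun θ hθ => hs.trans hθ.1
  have hS : slab r₁ r₂ s t
      = (fun p : ℝ × ℝ => polar (r₁ p.1 + p.2 * (r₂ p.1 - r₁ p.1)) p.1)
        '' (Set.Icc s t ×ˢ Set.Icc 0 1) := by
    ext x
    constructor
    · rintro ⟨θ, r, h1, h2, h3, h4, rfl⟩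
      have hlt := sub_pos.2 (h.lt θ (hs.trans h1))
      refine ⟨(θ, (r - r₁ θ) / (r₂ θ - r₁ θ)), ⟨⟨h1, h2⟩, ?_, ?_⟩, ?_⟩
      · exact div_nonneg (by linarith) hlt.le
      · rw [div_le_one hlt]
        linarith
      · simp [div_mul_cancel₀ _ hlt.ne']
    · rintro ⟨⟨θ, l⟩, ⟨⟨h1, h2⟩, h3, h4⟩, rfl⟩
      have hlt := sub_pos.2 (h.lt θ (hs.trans h1))
      simp only at h3 h4
      refine ⟨θ, _, h1, h2, ?_, ?_, rfl⟩
      · simp only [le_add_iff_nonneg_right]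
        positivity
      · simp only
        nlinarith
  have hfst : Set.MapsTo (Prod.fst : ℝ × ℝ → ℝ) (Set.Icc s t ×ˢ Set.Icc (0 : ℝ) 1) (Set.Icc s t) :=
    fun p hp => hp.1
  have c1 := (h.continuousOn_left.mono hsub).comp continuousOn_fst hfst
  have c2 := (h.continuousOn_right.mono hsub).comp continuousOn_fst hfst
  rw [hS]
  refine (isCompact_Icc.prod isCompact_Icc).image_of_continuousOn ?_
  exact continuous_polar.comp_continuousOn
    ((c1.add (continuousOn_snd.mul (c2.sub c1))).prodMk continuousOn_fst)

theorem abs_le_supAbs (h : IsProfile θ₀ r₁ r₂ rlim) {f : Plane → ℝ}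
    (hf : ContinuousOn f (domUt θ₀ r₁ r₂)) {θ : ℝ} (hθ : θ₀ ≤ θ) {x : Plane}
    (hx : x ∈ crossSec r₁ r₂ θ) : |f x| ≤ supAbs f (crossSec r₁ r₂ θ) :=
  (isGreatest_supAbs h hf hθ).2 ⟨x, hx, rfl⟩

/-- No boundedness is needed: the real `sSup` of an empty or unbounded set is `0`. -/
theorem supAbs_nonneg (f : Plane → ℝ) (S : Set Plane) : 0 ≤ supAbs f S :=
  Real.sSup_nonneg (by rintro _ ⟨x, -, rfl⟩; exact abs_nonneg _)

theorem supAbs_le {f : Plane → ℝ} {S : Set Plane} {K : ℝ} (hK : 0 ≤ K)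
    (h : ∀ x ∈ S, |f x| ≤ K) : supAbs f S ≤ K :=
  Real.sSup_le (by rintro _ ⟨x, hx, rfl⟩; exact h x hx) hK

/-! ### Null solutions and the maximum principle on slabs -/

/-- A solution of the homogeneous equation `L w = 0` in `U` that vanishes on the lateral boundary. -/
structure IsNullSolution (θ₀ : ℝ) (r₁ r₂ : ℝ → ℝ) (A : Plane → Matrix (Fin 2) (Fin 2) ℝ)
    (b : Plane → Plane) (w : Plane → ℝ) : Prop where
  contDiffOn : ContDiffOn ℝ 2 w (domU θ₀ r₁ r₂)
  continuousOn : ContinuousOn w (domUt θ₀ r₁ r₂)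
  opL_eq : ∀ x ∈ domU θ₀ r₁ r₂, opL A b w x = 0
  lateral_eq : ∀ x ∈ lateral θ₀ r₁ r₂, w x = 0

variable {A : Plane → Matrix (Fin 2) (Fin 2) ℝ} {b : Plane → Plane} {w : Plane → ℝ} {c₀ M₁ : ℝ}

theorem contDiffAt_of_mem_domU (h : IsProfile θ₀ r₁ r₂ rlim) {f : Plane → ℝ}
    (hf : ContDiffOn ℝ 2 f (domU θ₀ r₁ r₂)) {x : Plane} (hx : x ∈ domU θ₀ r₁ r₂) :
    ContDiffAt ℝ 2 f x :=
  hf.contDiffAt (domU_mem_nhds h hx)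

theorem IsNullSolution.neg (h : IsProfile θ₀ r₁ r₂ rlim)
    (hw : IsNullSolution θ₀ r₁ r₂ A b w) : IsNullSolution θ₀ r₁ r₂ A b (-w) where
  contDiffOn := hw.contDiffOn.neg
  continuousOn := hw.continuousOn.neg
  opL_eq x hx := by
    have := opL_const_smul A b (-1) (contDiffAt_of_mem_domU h hw.contDiffOn hx)
    rw [hw.opL_eq x hx] at this
    simpa using this
  lateral_eq x hx := by simp [hw.lateral_eq x hx]

theorem isNullSolution_sub (h : IsProfile θ₀ r₁ r₂ rlim) {u₁ u₂ : Plane → ℝ}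
    (h₁ : IsRegular θ₀ r₁ r₂ u₁) (h₂ : IsRegular θ₀ r₁ r₂ u₂)
    (hL : ∀ x ∈ domU θ₀ r₁ r₂, opL A b u₁ x = opL A b u₂ x)
    (hl : ∀ x ∈ lateral θ₀ r₁ r₂, u₁ x = u₂ x) :
    IsNullSolution θ₀ r₁ r₂ A b (u₁ - u₂) where
  contDiffOn := h₁.1.sub h₂.1
  continuousOn := h₁.2.sub h₂.2
  opL_eq x hx := by
    have c1 := contDiffAt_of_mem_domU h h₁.1 hx
    have c2 := contDiffAt_of_mem_domU h h₂.1 hx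
    have e : u₁ - u₂ = u₁ + (-1 : ℝ) • u₂ := by
      ext y
      simp [sub_eq_add_neg]
    have c2' : ContDiffAt ℝ 2 ((-1 : ℝ) • u₂) x := contDiffAt_const.smul c2
    rw [e, opL_add A b c1 c2', opL_const_smul A b _ c2, hL x hx]
    ring
  lateral_eq x hx := by simp [hl x hx]

/-- Comparison of a null solution with a multiple of an exponential barrier on a slab. -/
theorem IsNullSolution.add_barrier_le (h : IsProfile θ₀ r₁ r₂ rlim)
    (hA : IsElliptic (domU θ₀ r₁ r₂) A c₀ M₁) (hc₀ : 0 < c₀)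
    (hw : IsNullSolution θ₀ r₁ r₂ A b w) {s t B α P K : ℝ} {e : Plane} (hs : θ₀ ≤ s)
    (hB : ∀ x ∈ portion r₁ r₂ (Set.Ioo s t), ‖b x‖ ≤ B) (he : ‖e‖ = 1) (hα : 0 < α)
    (hαB : B < α * c₀) (hP : 0 < P)
    (hend : ∀ x ∈ crossSec r₁ r₂ s ∪ crossSec r₁ r₂ t, w x + P * Real.exp (α * inner ℝ e x) ≤ K)
    (hlat : ∀ x ∈ slab r₁ r₂ s t, x ∈ lateral θ₀ r₁ r₂ → P * Real.exp (α * inner ℝ e x) ≤ K) :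
    ∀ x ∈ slab r₁ r₂ s t, w x + P * Real.exp (α * inner ℝ e x) ≤ K := by
  intro y hy
  set g : Plane → ℝ := fun x => Real.exp (α * inner ℝ e x) with hg
  have hcg : ContDiff ℝ 2 g := contDiff_exp_inner α e
  have hcont : ContinuousOn (w + P • g) (slab r₁ r₂ s t) :=
    (hw.continuousOn.mono (slab_subset_domUt hs)).add (hcg.continuous.const_smul P).continuousOn
  obtain ⟨x, hx, hmax⟩ := (isCompact_slab h hs).exists_isMaxOn ⟨y, hy⟩ hcont
  have hyx : w y + P * g y ≤ w x + P * g x := hmax hy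
  refine hyx.trans ?_
  obtain ⟨θ, r, h1, h2, h3, h4, rfl⟩ := hx
  have hx' : polar r θ ∈ slab r₁ r₂ s t := ⟨θ, r, h1, h2, h3, h4, rfl⟩
  rcases h1.eq_or_lt with rfl | h1
  · exact hend _ (Or.inl ⟨r, h3, h4, rfl⟩)
  rcases h2.eq_or_lt with rfl | h2
  · exact hend _ (Or.inr ⟨r, h3, h4, rfl⟩)
  have hθ : θ₀ ≤ θ := hs.trans h1.le
  have hlat' : polar r θ ∈ lateral θ₀ r₁ r₂ → w (polar r θ) + P * g (polar r θ) ≤ K := by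
    intro hl
    rw [hw.lateral_eq _ hl, zero_add]
    exact hlat _ hx' hl
  rcases h3.eq_or_lt with rfl | h3
  · exact hlat' (Or.inl ⟨θ, hθ, rfl⟩)
  rcases h4.eq_or_lt with rfl | h4
  · exact hlat' (Or.inr ⟨θ, hθ, rfl⟩)
  -- At an interior maximum `L` of the sum would be nonnegative, whereas it equals `P` times the
  -- negative value of `L` on the barrier.
  exfalso
  have hU : polar r θ ∈ domU θ₀ r₁ r₂ := ⟨θ, r, hs.trans_lt h1, h3, h4, rfl⟩
  have hport : portion r₁ r₂ (Set.Ioo s t) ⊆ slab r₁ r₂ s t := by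
    rintro z ⟨θ', r', ⟨a1, a2⟩, a3, a4, rfl⟩
    exact ⟨θ', r', a1.le, a2.le, a3.le, a4.le, rfl⟩
  have hloc : IsLocalMax (w + P • g) (polar r θ) :=
    hmax.isLocalMax (mem_of_superset (portion_Ioo_mem_nhds h hs h1 h2 h3 h4) hport)
  have cw := contDiffAt_of_mem_domU h hw.contDiffOn hU
  have cg : ContDiffAt ℝ 2 g (polar r θ) := hcg.contDiffAt
  have cg' : ContDiffAt ℝ 2 (P • g) (polar r θ) := contDiffAt_const.smul cg
  have hpos : 0 ≤ opL A b (w + P • g) (polar r θ) :=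
    opL_nonneg_of_isLocalMax hA hc₀ b hU (cw.add cg') hloc
  rw [opL_add A b cw cg', opL_const_smul A b P cg, hw.opL_eq _ hU,
    hg, opL_exp_inner, zero_add] at hpos
  have hlow := hA.lower _ hU e
  rw [he] at hlow
  have hbe : inner ℝ (b (polar r θ)) e ≤ B := by
    refine (real_inner_le_norm _ _).trans ?_
    rw [he, mul_one]
    exact hB _ ⟨θ, r, ⟨h1, h2⟩, h3, h4, rfl⟩
  have hneg : inner ℝ (b (polar r θ)) e
      - α * ∑ i, ∑ j, e i * A (polar r θ) i j * e j < 0 := by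
    have := mul_le_mul_of_nonneg_left hlow hα.le
    linarith
  have : P * (α * Real.exp (α * inner ℝ e (polar r θ)) * (inner ℝ (b (polar r θ)) e
      - α * ∑ i, ∑ j, e i * A (polar r θ) i j * e j)) < 0 :=
    mul_neg_of_pos_of_neg hP (mul_neg_of_pos_of_neg (by positivity) hneg)
  linarith

theorem crossSec_subset_slab {s t θ : ℝ} (h1 : s ≤ θ) (h2 : θ ≤ t) :
    crossSec r₁ r₂ θ ⊆ slab r₁ r₂ s t := by
  rintro x ⟨r, h3, h4, rfl⟩
  exact ⟨θ, r, h1, h2, h3, h4, rfl⟩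

/-- Any barrier direction serves here; its multiple is scaled so that it adds at most `ε` on the
compact slab, and `ε` tends to zero. -/
theorem IsNullSolution.le_max_supAbs (h : IsProfile θ₀ r₁ r₂ rlim)
    (hA : IsElliptic (domU θ₀ r₁ r₂) A c₀ M₁) (hc₀ : 0 < c₀)
    (hw : IsNullSolution θ₀ r₁ r₂ A b w) {s t B : ℝ} (hs : θ₀ ≤ s) (hst : s ≤ t)
    (hB : ∀ x ∈ portion r₁ r₂ (Set.Ioo s t), ‖b x‖ ≤ B) :
    ∀ x ∈ slab r₁ r₂ s t, w x ≤ max (supAbs w (crossSec r₁ r₂ s)) (supAbs w (crossSec r₁ r₂ t)) := by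
  intro y hy
  set K := max (supAbs w (crossSec r₁ r₂ s)) (supAbs w (crossSec r₁ r₂ t)) with hKdef
  have hK : 0 ≤ K := (supAbs_nonneg _ _).trans (le_max_left _ _)
  set α : ℝ := (|B| + 1) / c₀ with hα
  have hα0 : 0 < α := by positivity
  have hαB : B < α * c₀ := by
    rw [hα, div_mul_cancel₀ _ hc₀.ne']
    linarith [le_abs_self B]
  set e := polar 1 0
  set g : Plane → ℝ := fun x => Real.exp (α * inner ℝ e x) with hg
  have hcg : Continuous g := (contDiff_exp_inner α e).continuous
  obtain ⟨D, hD⟩ := (isCompact_slab h hs (t := t)).bddAbove_image hcg.continuousOn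
  have hD' : ∀ x ∈ slab r₁ r₂ s t, g x ≤ D := fun x hx => hD ⟨x, hx, rfl⟩
  refine le_of_forall_pos_le_add fun ε hε => ?_
  have hDpos : 0 < D := (Real.exp_pos _).trans_le (hD' y hy)
  have hP : 0 < ε / D := by positivity
  have hPg : ∀ x ∈ slab r₁ r₂ s t, ε / D * g x ≤ ε := by
    intro x hx
    have := mul_le_mul_of_nonneg_left (hD' x hx) hP.le
    rwa [div_mul_cancel₀ _ hDpos.ne'] at this
  have key := hw.add_barrier_le h hA hc₀ hs hB (norm_polar_one 0) hα0 hαB hP (K := K + ε)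
    (by
      rintro x (hx | hx)
      · have h1 := le_of_abs_le (abs_le_supAbs h hw.continuousOn hs hx)
        have h2 := hPg x (crossSec_subset_slab le_rfl hst hx)
        exact add_le_add (h1.trans (le_max_left _ _)) h2
      · have h1 := le_of_abs_le (abs_le_supAbs h hw.continuousOn (hs.trans hst) hx)
        have h2 := hPg x (crossSec_subset_slab hst le_rfl hx)
        exact add_le_add (h1.trans (le_max_right _ _)) h2)
    (fun x hx _ => (hPg x hx).trans (by linarith)) y hy
  have : 0 < ε / D * g y := mul_pos hP (Real.exp_pos _)
  have key' : w y + ε / D * g y ≤ K + ε := key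
  linarith

theorem supAbs_neg (f : Plane → ℝ) (S : Set Plane) : supAbs (-f) S = supAbs f S := by
  simp [supAbs]

/-- The maximum principle for a null solution on a slab. -/
theorem IsNullSolution.supAbs_le_max (h : IsProfile θ₀ r₁ r₂ rlim)
    (hA : IsElliptic (domU θ₀ r₁ r₂) A c₀ M₁) (hc₀ : 0 < c₀)
    (hw : IsNullSolution θ₀ r₁ r₂ A b w) {s θ t B : ℝ} (hs : θ₀ ≤ s) (hsθ : s ≤ θ) (hθt : θ ≤ t)
    (hB : ∀ x ∈ portion r₁ r₂ (Set.Ioo s t), ‖b x‖ ≤ B) :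
    supAbs w (crossSec r₁ r₂ θ)
      ≤ max (supAbs w (crossSec r₁ r₂ s)) (supAbs w (crossSec r₁ r₂ t)) := by
  refine supAbs_le ((supAbs_nonneg _ _).trans (le_max_left _ _)) fun x hx => ?_
  have hx' := crossSec_subset_slab hsθ hθt hx
  have h1 := hw.le_max_supAbs h hA hc₀ hs (hsθ.trans hθt) hB x hx'
  have h2 := (hw.neg h).le_max_supAbs h hA hc₀ hs (hsθ.trans hθt) hB x hx'
  rw [supAbs_neg, supAbs_neg, Pi.neg_apply] at h2
  exact abs_le.2 ⟨by linarith, h1⟩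

/-! ### Contraction across a window -/

/-- Write `E = exp (-(α R))`. The barrier, normalised to be at most `N` on the slab, is at most `N *
E ^ 2` on the two end sections and at least `N * E` on the middle one. Comparison gives `w + N * E ≤
N + N * E ^ 2` in the middle. -/
theorem IsNullSolution.le_mul_max (h : IsProfile θ₀ r₁ r₂ rlim)
    (hA : IsElliptic (domU θ₀ r₁ r₂) A c₀ M₁) (hc₀ : 0 < c₀)
    (hw : IsNullSolution θ₀ r₁ r₂ A b w) {a B α R : ℝ} (ha : θ₀ ≤ a - 1)
    (hB : ∀ x ∈ portion r₁ r₂ (Set.Ioo (a - 1) (a + 1)), ‖b x‖ ≤ B) (hα : 0 < α)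
    (hαB : B < α * c₀) (hR : 2 * R ≤ rlim * (1 - Real.cos 1))
    (hr : ∀ θ, a - 1 ≤ θ → r₂ θ ≤ rlim + R) :
    ∀ x ∈ crossSec r₁ r₂ a, w x ≤ (1 - Real.exp (-(α * R)) * (1 - Real.exp (-(α * R))))
      * max (supAbs w (crossSec r₁ r₂ (a - 1))) (supAbs w (crossSec r₁ r₂ (a + 1))) := by
  intro y hy
  set M := max (supAbs w (crossSec r₁ r₂ (a - 1))) (supAbs w (crossSec r₁ r₂ (a + 1))) with hM
  have hM0 : 0 ≤ M := (supAbs_nonneg _ _).trans (le_max_left _ _)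
  have ha' : θ₀ ≤ a := by linarith
  -- the bound with `M` replaced by any larger number
  suffices H : ∀ N, 0 < N → M ≤ N →
      w y ≤ (1 - Real.exp (-(α * R)) * (1 - Real.exp (-(α * R)))) * N by
    refine ge_of_tendsto (x := 𝓝[>] M) (f := fun N => (1 - Real.exp (-(α * R))
      * (1 - Real.exp (-(α * R)))) * N) ?_ ?_
    · exact ((continuous_const.mul continuous_id).tendsto M).mono_left nhdsWithin_le_nhds
    · filter_upwards [self_mem_nhdsWithin] with N hN
      exact H N (hM0.trans_lt hN) (le_of_lt hN)
  intro N hN hMN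
  set e := polar 1 a with he
  -- `qm` bounds every radius in the window, hence `⟨e, x⟩`; dividing by `exp (α * qm)` normalises
  -- the barrier.
  set qm := rlim + R
  have hP : 0 < N * Real.exp (-(α * qm)) := by positivity
  have hqm : 0 ≤ qm := ((h.pos_right a ha').le).trans (hr a (by linarith))
  have hinner : ∀ r θ, inner ℝ e (polar r θ) = r * Real.cos (θ - a) := by
    intro r θ
    rw [he, inner_polar, one_mul]
  have hle : ∀ c q : ℝ, q ≤ c →
      N * Real.exp (-(α * qm)) * Real.exp (α * q) ≤ N * Real.exp (α * (c - qm)) := by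
    intro c q hq
    rw [mul_assoc, ← Real.exp_add]
    refine mul_le_mul_of_nonneg_left (Real.exp_le_exp.2 ?_) hN.le
    nlinarith
  have hcos1 : 0 ≤ Real.cos 1 := Real.cos_one_pos.le
  have hends : ∀ θ, a - 1 ≤ θ → Real.cos (θ - a) = Real.cos 1 → supAbs w (crossSec r₁ r₂ θ) ≤ M →
      ∀ x ∈ crossSec r₁ r₂ θ, w x + N * Real.exp (-(α * qm)) * Real.exp (α * inner ℝ e x)
        ≤ N + N * Real.exp (α * (qm * Real.cos 1 - qm)) := by
    intro θ hθ hcos hsup x hx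
    have h1 := le_of_abs_le (abs_le_supAbs h hw.continuousOn (ha.trans hθ) hx)
    obtain ⟨r, -, h4, rfl⟩ := hx
    refine add_le_add (by linarith) (hle _ _ ?_)
    rw [hinner, hcos]
    exact mul_le_mul_of_nonneg_right (h4.trans (hr θ hθ)) hcos1
  have key := hw.add_barrier_le h hA hc₀ ha hB (norm_polar_one a) hα hαB hP
    (K := N + N * Real.exp (α * (qm * Real.cos 1 - qm)))
    (by
      rintro x (hx | hx)
      · exact hends (a - 1) le_rfl (by rw [← Real.cos_neg]; congr 1; ring) (le_max_left _ _) x hx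
      · exact hends (a + 1) (by linarith) (by congr 1; ring) (le_max_right _ _) x hx)
    (by
      rintro x ⟨θ, r, h1, -, h3, h4, rfl⟩ -
      have hr0 : 0 ≤ r := (h.pos_left θ (ha.trans h1)).le.trans h3
      have hq : inner ℝ e (polar r θ) ≤ qm := by
        rw [hinner]
        exact (mul_le_of_le_one_right hr0 (Real.cos_le_one _)).trans (h4.trans (hr θ h1))
      have := hle _ _ hq
      rw [sub_self, mul_zero, Real.exp_zero, mul_one] at this
      have : 0 ≤ N * Real.exp (α * (qm * Real.cos 1 - qm)) := by positivity
      linarith)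
    y (crossSec_subset_slab (by linarith) (by linarith) hy)
  obtain ⟨r, h3, -, rfl⟩ := hy
  rw [hinner, sub_self, Real.cos_zero, mul_one, mul_assoc, ← Real.exp_add] at key
  -- The middle section lies outside the limit circle, which bounds the barrier from below there.
  have hrr : rlim ≤ r := (h.rlim_le_left ha').trans h3
  have e1 : Real.exp (-(α * R)) ≤ Real.exp (-(α * qm) + α * r) := by
    refine Real.exp_le_exp.2 ?_
    have : α * rlim ≤ α * r := mul_le_mul_of_nonneg_left hrr hα.le
    have : α * qm = α * rlim + α * R := by ring
    linarith
  have e2 : Real.exp (α * (qm * Real.cos 1 - qm)) ≤ Real.exp (-(α * R)) * Real.exp (-(α * R)) := by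
    rw [← Real.exp_add]
    refine Real.exp_le_exp.2 ?_
    have hc1 : Real.cos 1 ≤ 1 := Real.cos_le_one 1
    have hR0 : rlim ≤ qm := (h.rlim_le_left ha').trans ((h.lt a ha').le.trans (hr a (by linarith)))
    -- The drop of `⟨e, x⟩` caused by one radian of curvature is at least twice the thickness `R`.
    have : 2 * R ≤ qm * (1 - Real.cos 1) :=
      hR.trans (mul_le_mul_of_nonneg_right hR0 (by linarith))
    nlinarith [mul_le_mul_of_nonneg_left this hα.le]
  have e1' := mul_le_mul_of_nonneg_left e1 hN.le
  have e2' := mul_le_mul_of_nonneg_left e2 hN.le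
  linarith

/-- The decay of a null solution across a window of two radians where the spiral is thin. -/
theorem IsNullSolution.supAbs_le_mul_max (h : IsProfile θ₀ r₁ r₂ rlim)
    (hA : IsElliptic (domU θ₀ r₁ r₂) A c₀ M₁) (hc₀ : 0 < c₀)
    (hw : IsNullSolution θ₀ r₁ r₂ A b w) {a B α R : ℝ} (ha : θ₀ ≤ a - 1)
    (hB : ∀ x ∈ portion r₁ r₂ (Set.Ioo (a - 1) (a + 1)), ‖b x‖ ≤ B) (hα : 0 < α)
    (hαB : B < α * c₀) (hR0 : 0 ≤ R) (hR : 2 * R ≤ rlim * (1 - Real.cos 1))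
    (hr : ∀ θ, a - 1 ≤ θ → r₂ θ ≤ rlim + R) :
    supAbs w (crossSec r₁ r₂ a) ≤ (1 - Real.exp (-(α * R)) * (1 - Real.exp (-(α * R))))
      * max (supAbs w (crossSec r₁ r₂ (a - 1))) (supAbs w (crossSec r₁ r₂ (a + 1))) := by
  have hE : Real.exp (-(α * R)) ≤ 1 := Real.exp_le_one_iff.2 (by nlinarith)
  have hE0 := Real.exp_pos (-(α * R))
  refine supAbs_le (mul_nonneg (by nlinarith)
    ((supAbs_nonneg _ _).trans (le_max_left _ _))) fun x hx => ?_
  have h1 := hw.le_mul_max h hA hc₀ ha hB hα hαB hR hr x hx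
  have h2 := (hw.neg h).le_mul_max h hA hc₀ ha hB hα hαB hR hr x hx
  rw [supAbs_neg, supAbs_neg, Pi.neg_apply] at h2
  exact abs_le.2 ⟨by linarith, h1⟩

/-! ### Sequences contracted by one of their neighbours -/

/-- If each term of a sequence is smaller by the factor `1 - d n` than one of its two neighbours and
the sequence does not grow like `exp (∑ d)`, then it decays. -/
theorem succ_le_of_succ_le_max {x d : ℕ → ℝ} (hx : ∀ n, 0 ≤ x n) (hd : ∀ n, 0 < d n)
    (hd1 : ∀ n, d n ≤ 1)
    (hmax : ∀ n, x (n + 1) ≤ (1 - d n) * max (x n) (x (n + 2)))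
    (hgrow : ∀ c > 0, ∀ N, ∃ k,
      x (N + 1 + k) < c * Real.exp (∑ j ∈ Finset.range k, d (N + j))) (n : ℕ) :
    x (n + 1) ≤ (1 - d n) * x n := by
  by_contra! hn
  have step : ∀ k, (1 - d k) * x k < x (k + 1) → x (k + 1) ≤ (1 - d k) * x (k + 2) := by
    intro k hk
    have := hmax k
    rcases max_cases (x k) (x (k + 2)) with ⟨h1, -⟩ | ⟨h1, -⟩ <;> rw [h1] at this
    · exact absurd this hk.not_ge
    · exact this
  have hpos : 0 < x (n + 1) := (mul_nonneg (sub_nonneg.2 (hd1 n)) (hx n)).trans_lt hn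
  -- Once a term is not controlled by its predecessor it is controlled by its successor. The
  -- sequence then does not decrease there, so the next term is not controlled by its predecessor
  -- either, and this persists.
  have main : ∀ k, 0 < x (n + k + 1) ∧ x (n + k + 1) ≤ (1 - d (n + k)) * x (n + k + 2) := by
    intro k
    induction k with
    | zero => exact ⟨hpos, step n hn⟩
    | succ k ih =>
      obtain ⟨h1, h2⟩ := ih
      have hle : x (n + k + 1) ≤ x (n + k + 2) :=
        h2.trans (mul_le_of_le_one_left (hx _) (by linarith [hd (n + k)]))
      have hp : 0 < x (n + k + 2) := h1.trans_le hle
      refine ⟨hp, step (n + k + 1) ?_⟩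
      calc (1 - d (n + k + 1)) * x (n + k + 1)
          ≤ (1 - d (n + k + 1)) * x (n + k + 2) :=
            mul_le_mul_of_nonneg_left hle (sub_nonneg.2 (hd1 _))
        _ < x (n + k + 2) := by nlinarith [mul_pos (hd (n + k + 1)) hp]
  -- From `1 - d ≤ exp (-d)`, each step multiplies by at least `exp d`.
  have hgr : ∀ k, x (n + 1) * Real.exp (∑ j ∈ Finset.range k, d (n + j)) ≤ x (n + 1 + k) := by
    intro k
    induction k with
    | zero => simp
    | succ k ih =>
      rw [Finset.sum_range_succ, Real.exp_add, ← mul_assoc]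
      have h1 : x (n + 1 + k) ≤ Real.exp (-d (n + k)) * x (n + 1 + (k + 1)) := by
        have h2 := (main k).2
        rw [show n + k + 1 = n + 1 + k by ring, show n + k + 2 = n + 1 + (k + 1) by ring] at h2
        refine h2.trans (mul_le_mul_of_nonneg_right ?_ (hx _))
        linarith [Real.add_one_le_exp (-d (n + k))]
      calc _ ≤ Real.exp (-d (n + k)) * x (n + 1 + (k + 1)) * Real.exp (d (n + k)) :=
            mul_le_mul_of_nonneg_right (ih.trans h1) (Real.exp_pos _).le
        _ = x (n + 1 + (k + 1)) := by
            rw [mul_right_comm, ← Real.exp_add]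
            simp
  obtain ⟨k, hk⟩ := hgrow _ hpos n
  exact absurd (hgr k) hk.not_ge

theorem le_mul_exp_neg_sum {x d : ℕ → ℝ} (hx : ∀ n, 0 ≤ x n)
    (h : ∀ n, x (n + 1) ≤ (1 - d n) * x n) (n : ℕ) :
    x n ≤ x 0 * Real.exp (-∑ j ∈ Finset.range n, d j) := by
  induction n with
  | zero => simp
  | succ n ih =>
    rw [Finset.sum_range_succ, neg_add, Real.exp_add, ← mul_assoc]
    calc x (n + 1) ≤ (1 - d n) * x n := h n
      _ ≤ Real.exp (-d n) * x n :=
        mul_le_mul_of_nonneg_right (by linarith [Real.add_one_le_exp (-d n)]) (hx n)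
      _ ≤ Real.exp (-d n) * (x 0 * Real.exp (-∑ j ∈ Finset.range n, d j)) :=
        mul_le_mul_of_nonneg_left ih (Real.exp_pos _).le
      _ = _ := by ring

/-- Decay of a function that obeys a maximum principle and contracts along an arithmetic
progression. -/
theorem antitone_and_decay {M : ℝ → ℝ} {θ₀ T : ℝ} {d : ℕ → ℝ} (hT : θ₀ ≤ T) (hM : ∀ θ, 0 ≤ M θ)
    (hmp : ∀ s θ t, θ₀ ≤ s → s ≤ θ → θ ≤ t → M θ ≤ max (M s) (M t))
    (hd : ∀ n, 0 < d n) (hd1 : ∀ n, d n ≤ 1)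
    (hwin : ∀ n : ℕ, M (T + n + 1) ≤ (1 - d n) * max (M (T + n)) (M (T + n + 2)))
    (hdiv : Tendsto (fun n => ∑ j ∈ Finset.range n, d j) atTop atTop)
    (hgrow : ∀ c > 0, ∀ N : ℕ, ∃ k : ℕ,
      M (T + N + 1 + k) < c * Real.exp (∑ j ∈ Finset.range k, d (N + j))) :
    (∀ s θ, θ₀ ≤ s → s ≤ θ → M θ ≤ M s) ∧
      ∀ (n : ℕ) (θ : ℝ), T + n ≤ θ → M θ ≤ M θ₀ * Real.exp (-∑ j ∈ Finset.range n, d j) := by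
  have hstep := succ_le_of_succ_le_max (x := fun n : ℕ => M (T + n)) (fun n => hM _) hd hd1
    (fun n => by simpa [add_assoc] using hwin n)
    (fun c hc N => by simpa [add_assoc] using hgrow c hc N)
  have hdec : ∀ n : ℕ, M (T + n) ≤ M T * Real.exp (-∑ j ∈ Finset.range n, d j) := fun n => by
    simpa using le_mul_exp_neg_sum (x := fun n : ℕ => M (T + n)) (fun n => hM _) hstep n
  have hlim : Tendsto (fun n : ℕ => M (T + n)) atTop (𝓝 0) := by
    refine squeeze_zero (fun n => hM _) hdec ?_
    simpa using (Real.tendsto_exp_atBot.comp (tendsto_neg_atTop_atBot.comp hdiv)).const_mul (M T)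
  have hanti : ∀ s θ, θ₀ ≤ s → s ≤ θ → M θ ≤ M s := by
    intro s θ hs hsθ
    -- The maximum principle is applied between `s` and `T + n`; as `n → ∞` the far section
    -- contributes nothing.
    have hl : Tendsto (fun n : ℕ => max (M s) (M (T + n))) atTop (𝓝 (max (M s) 0)) :=
      tendsto_const_nhds.max hlim
    rw [max_eq_left (hM s)] at hl
    refine ge_of_tendsto hl ?_
    have : Tendsto (fun n : ℕ => T + (n : ℝ)) atTop atTop :=
      tendsto_atTop_add_const_left _ _ tendsto_natCast_atTop_atTop
    filter_upwards [this.eventually_ge_atTop θ] with n hn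
    exact hmp s θ _ hs hsθ hn
  refine ⟨hanti, fun n θ hθ => ?_⟩
  have hn : (0 : ℝ) ≤ n := n.cast_nonneg
  calc M θ ≤ M (T + n) := hanti _ _ (by linarith) hθ
    _ ≤ M T * Real.exp (-∑ j ∈ Finset.range n, d j) := hdec n
    _ ≤ _ := mul_le_mul_of_nonneg_right (hanti _ _ le_rfl hT) (Real.exp_pos _).le

/-! ### Bounded drift -/

theorem BelowExpGrowth.sub (h : IsProfile θ₀ r₁ r₂ rlim) {u₁ u₂ : Plane → ℝ}
    (hc₁ : ContinuousOn u₁ (domUt θ₀ r₁ r₂)) (hc₂ : ContinuousOn u₂ (domUt θ₀ r₁ r₂))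
    (h₁ : BelowExpGrowth θ₀ r₁ r₂ u₁) (h₂ : BelowExpGrowth θ₀ r₁ r₂ u₂) {ε : ℝ} (hε : 0 < ε) :
    Tendsto (fun θ => Real.exp (-ε * θ) * supAbs (u₁ - u₂) (crossSec r₁ r₂ θ)) atTop (𝓝 0) := by
  have hsum := (h₁ ε hε).add (h₂ ε hε)
  rw [add_zero] at hsum
  refine squeeze_zero' (Eventually.of_forall fun θ =>
    mul_nonneg (Real.exp_pos _).le (supAbs_nonneg _ _)) ?_ hsum
  filter_upwards [eventually_ge_atTop θ₀] with θ hθ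
  rw [← mul_add, Set.inter_eq_left.2 (crossSec_subset_domUt hθ)]
  refine mul_le_mul_of_nonneg_left (supAbs_le
    (add_nonneg (supAbs_nonneg _ _) (supAbs_nonneg _ _)) fun x hx => ?_) (Real.exp_pos _).le
  exact (abs_sub _ _).trans (add_le_add (abs_le_supAbs h hc₁ hθ hx) (abs_le_supAbs h hc₂ hθ hx))

theorem one_sub_cos_one_pos : 0 < 1 - Real.cos 1 := by
  linarith [Real.cos_one_le]

theorem IsProfile.exists_forall_right_le (h : IsProfile θ₀ r₁ r₂ rlim) {R : ℝ} (hR : 0 < R)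
    (Θ : ℝ) : ∃ T, Θ ≤ T ∧ ∀ θ, T ≤ θ → r₂ θ ≤ rlim + R := by
  obtain ⟨T, hT⟩ := eventually_atTop.1
    (h.tendsto_right.eventually_le_const (lt_add_of_pos_right rlim hR))
  exact ⟨max T Θ, le_max_right _ _, fun θ hθ => hT θ ((le_max_left _ _).trans hθ)⟩

theorem exp_mul_one_sub_exp_pos {x : ℝ} (hx : 0 < x) :
    0 < Real.exp (-x) * (1 - Real.exp (-x)) :=
  mul_pos (Real.exp_pos _) (sub_pos.2 (Real.exp_lt_one_iff.2 (neg_lt_zero.2 hx)))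

theorem bounded_drift_decay (h : IsProfile θ₀ r₁ r₂ rlim) {c₀ : ℝ} (hc₀ : 0 < c₀) {M₂ : ℝ}
    (hM₂ : 0 ≤ M₂) :
    ∃ C ν : ℝ, 0 < C ∧ 0 < ν ∧ ∀ (M₁ : ℝ) (A : Plane → Matrix (Fin 2) (Fin 2) ℝ)
      (b : Plane → Plane) (w : Plane → ℝ), IsElliptic (domU θ₀ r₁ r₂) A c₀ M₁ →
      (∀ x ∈ domU θ₀ r₁ r₂, ‖b x‖ ≤ M₂) → IsNullSolution θ₀ r₁ r₂ A b w →
      (∀ ε > 0, Tendsto (fun θ => Real.exp (-ε * θ) * supAbs w (crossSec r₁ r₂ θ)) atTop (𝓝 0)) →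
      (∀ θ, θ₀ ≤ θ → supAbs w (crossSec r₁ r₂ θ) ≤ supAbs w (crossSec r₁ r₂ θ₀)) ∧
      ∀ θ, θ₀ ≤ θ → supAbs w (crossSec r₁ r₂ θ)
        ≤ C * supAbs w (crossSec r₁ r₂ θ₀) * Real.exp (-ν * (θ - θ₀)) := by
  set R := rlim * (1 - Real.cos 1) / 2 with hR
  have hR0 : 0 < R := by
    have := mul_pos h.rlim_pos one_sub_cos_one_pos
    positivity
  obtain ⟨T, hT, hr⟩ := h.exists_forall_right_le hR0 θ₀
  set α := (M₂ + 1) / c₀ with hα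
  have hα0 : 0 < α := by positivity
  have hαB : M₂ < α * c₀ := by
    rw [hα, div_mul_cancel₀ _ hc₀.ne']
    linarith
  set d := Real.exp (-(α * R)) * (1 - Real.exp (-(α * R))) with hd
  have hd0 : 0 < d := exp_mul_one_sub_exp_pos (by positivity)
  have hd1 : d ≤ 1 := by
    have h1 : Real.exp (-(α * R)) ≤ 1 := Real.exp_le_one_iff.2 (by
      have : 0 < α * R := by positivity
      linarith)
    have h2 := Real.exp_pos (-(α * R))
    rw [hd]
    nlinarith
  -- The decay starts only at `T`, and rounding `θ - T` down to an integer loses at most one unit;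
  -- the constant absorbs both.
  refine ⟨Real.exp (d * (T + 1 - θ₀)), d, Real.exp_pos _, hd0, ?_⟩
  intro M₁ A b w hA hb hw hgrow
  set M : ℝ → ℝ := fun θ => supAbs w (crossSec r₁ r₂ θ) with hM
  have hM0 : ∀ θ, 0 ≤ M θ := fun θ => supAbs_nonneg _ _
  have hb' : ∀ s t, θ₀ ≤ s → ∀ x ∈ portion r₁ r₂ (Set.Ioo s t), ‖b x‖ ≤ M₂ :=
    fun s t hs x hx => hb x (portion_subset_domU (fun θ hθ => hs.trans_lt hθ.1) hx)
  have key := antitone_and_decay (M := M) (d := fun _ => d) hT hM0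
    (fun s θ t hs h1 h2 => hw.supAbs_le_max h hA hc₀ hs h1 h2 (hb' s t hs))
    (fun _ => hd0) (fun _ => hd1)
    (fun n => by
      have hn : (0 : ℝ) ≤ n := n.cast_nonneg
      have := hw.supAbs_le_mul_max h hA hc₀ (a := T + n + 1) (by linarith)
        (hb' _ _ (by linarith)) hα0 hαB hR0.le (by rw [hR]; linarith)
        (fun θ hθ => hr θ (by linarith))
      rwa [show T + n + 1 - 1 = T + (n : ℝ) by ring,
        show T + n + 1 + 1 = T + (n : ℝ) + 2 by ring] at this)
    (by
      simp only [Finset.sum_const, Finset.card_range, nsmul_eq_mul]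
      exact tendsto_natCast_atTop_atTop.atTop_mul_const hd0)
    (by
      intro c hc N
      have h1 : Tendsto (fun k : ℕ => T + N + 1 + (k : ℝ)) atTop atTop :=
        tendsto_atTop_add_const_left _ _ tendsto_natCast_atTop_atTop
      -- The sums of `d` are `k * d`, so growth below `exp (ε θ)` with `ε = d` suffices.
      have hc' : 0 < c * Real.exp (-d * (T + N + 1)) := by positivity
      obtain ⟨k, hk⟩ := (((hgrow d hd0).comp h1).eventually_lt_const hc').exists
      refine ⟨k, ?_⟩
      simp only [Finset.sum_const, Finset.card_range, nsmul_eq_mul]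
      simp only [Function.comp_apply] at hk
      rw [mul_add, Real.exp_add, mul_right_comm, mul_comm c, mul_comm,
        ← mul_assoc, mul_comm _ (Real.exp (-d * (T + N + 1))), mul_assoc] at hk
      have hk' := lt_of_mul_lt_mul_left hk (Real.exp_pos _).le
      have e : Real.exp (-d * k) * Real.exp (k * d) = 1 := by
        rw [← Real.exp_add, Real.exp_eq_one_iff]
        ring
      calc M (T + N + 1 + k) = M (T + N + 1 + k) * Real.exp (-d * k) * Real.exp (k * d) := by
            rw [mul_assoc, e, mul_one]
        _ < c * Real.exp (k * d) := mul_lt_mul_of_pos_right ((mul_comm _ _).trans_lt hk') (Real.exp_pos _))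
  obtain ⟨hanti, hdec⟩ := key
  refine ⟨fun θ hθ => hanti θ₀ θ le_rfl hθ, fun θ hθ => ?_⟩
  have hgoal : M θ ≤ M θ₀ * Real.exp (d * (T + 1 - θ)) → M θ
      ≤ Real.exp (d * (T + 1 - θ₀)) * M θ₀ * Real.exp (-d * (θ - θ₀)) := by
    intro H
    rw [mul_comm (Real.exp _) (M θ₀), mul_assoc, ← Real.exp_add]
    convert H using 3
    ring
  refine hgoal ?_
  rcases le_total T θ with hTθ | hTθ
  · have hf := Nat.floor_le (sub_nonneg.2 hTθ)
    have hf' := Nat.lt_floor_add_one (θ - T)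
    refine (hdec ⌊θ - T⌋₊ θ (by linarith)).trans (mul_le_mul_of_nonneg_left ?_ (hM0 _))
    simp only [Finset.sum_const, Finset.card_range, nsmul_eq_mul]
    refine Real.exp_le_exp.2 ?_
    nlinarith
  · refine (hanti θ₀ θ le_rfl hθ).trans (le_mul_of_one_le_right (hM0 _) (Real.one_le_exp ?_))
    have : 0 ≤ T + 1 - θ := by linarith
    positivity

/-! ### Unbounded drift -/

theorem IsRate.antitoneOn {Θ κ : ℝ} {m : ℝ → ℝ} (hm : IsRate θ₀ Θ m κ) :
    AntitoneOn (fun ζ => κ ^ m ζ) (Set.Ici Θ) := fun _ hx _ hy hxy =>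
  Real.rpow_le_rpow_of_exponent_ge hm.kappa_pos hm.kappa_lt_one.le (hm.mono hx hy hxy)

theorem IsRate.intervalIntegrable {Θ κ : ℝ} {m : ℝ → ℝ} (hm : IsRate θ₀ Θ m κ) {s t : ℝ}
    (hs : Θ ≤ s) (ht : Θ ≤ t) :
    IntervalIntegrable (fun ζ => κ ^ m ζ) MeasureTheory.volume s t :=
  (hm.antitoneOn.mono fun _ hx => (le_min hs ht).trans hx.1).intervalIntegrable

theorem IsRate.integral_le_sum {Θ κ : ℝ} {m : ℝ → ℝ} (hm : IsRate θ₀ Θ m κ) {s : ℝ}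
    (hs : Θ ≤ s) (n : ℕ) :
    ∫ ζ in s..s + n, κ ^ m ζ ≤ ∑ j ∈ Finset.range n, κ ^ m (s + j) :=
  AntitoneOn.integral_le_sum (hm.antitoneOn.mono fun _ hx => hs.trans hx.1)

theorem IsRate.tendsto_sum {Θ κ : ℝ} {m : ℝ → ℝ} (hm : IsRate θ₀ Θ m κ) {s : ℝ}
    (hs : Θ ≤ s) :
    Tendsto (fun n => ∑ j ∈ Finset.range n, κ ^ m (s + j)) atTop atTop := by
  refine tendsto_atTop_mono (hm.integral_le_sum hs) ?_
  have h1 : Tendsto (fun n : ℕ => s + (n : ℝ)) atTop atTop :=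
    tendsto_atTop_add_const_left _ _ tendsto_natCast_atTop_atTop
  have h2 := tendsto_atTop_add_const_left atTop (-∫ ζ in Θ..s, κ ^ m ζ)
    (hm.integral_eq_top.comp h1)
  refine h2.congr fun n => ?_
  have hn : (0 : ℝ) ≤ n := n.cast_nonneg
  have := intervalIntegral.integral_add_adjacent_intervals
    (hm.intervalIntegrable le_rfl hs) (hm.intervalIntegrable hs (t := s + n) (by linarith))
  simp only [Function.comp_apply]
  linarith

/-- The maximum principle needs only some bound on each slab, which never enters the estimates. -/
theorem DriftLe.bounded {Θ κ : ℝ} {m : ℝ → ℝ} {b : Plane → Plane} (hm : IsRate θ₀ Θ m κ)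
    (hb : DriftLe θ₀ r₁ r₂ Θ m b) {s : ℝ} (hs : θ₀ ≤ s) (t : ℝ) :
    ∃ B, ∀ x ∈ portion r₁ r₂ (Set.Ioo s t), ‖b x‖ ≤ B := by
  obtain ⟨B, hB⟩ := hb.bounded_start
  refine ⟨max B (m t), fun x hx => ?_⟩
  have hU := portion_subset_domU (fun θ hθ => hs.trans_lt hθ.1) hx
  obtain ⟨θ, r, hθ, h1, h2, rfl⟩ := hx
  rcases le_total θ Θ with h | h
  · exact (hB _ ⟨hU, θ, r, ⟨hs.trans hθ.1.le, h⟩, h1, h2, rfl⟩).trans (le_max_left _ _)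
  · exact (hb.le_rate θ h _ ⟨hU, r, h1.le, h2.le, rfl⟩).trans
      ((hm.mono h (h.trans hθ.2.le) hθ.2.le).trans (le_max_right _ _))

theorem unbounded_drift_decay (h : IsProfile θ₀ r₁ r₂ rlim) {c₀ : ℝ} (hc₀ : 0 < c₀)
    {Θ κ : ℝ} {m : ℝ → ℝ} (hm : IsRate θ₀ Θ m κ) :
    ∃ Θ₀ ν : ℝ, Θ ≤ Θ₀ ∧ 0 < ν ∧ ∀ (M₁ : ℝ) (A : Plane → Matrix (Fin 2) (Fin 2) ℝ)
      (b : Plane → Plane) (w : Plane → ℝ), IsElliptic (domU θ₀ r₁ r₂) A c₀ M₁ →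
      DriftLe θ₀ r₁ r₂ Θ m b → IsNullSolution θ₀ r₁ r₂ A b w →
      (∃ B, ∀ x ∈ domUt θ₀ r₁ r₂, |w x| ≤ B) → ∀ θ, θ₀ ≤ θ →
        supAbs w (crossSec r₁ r₂ θ) ≤ supAbs w (crossSec r₁ r₂ θ₀)
          * min 1 (Real.exp (-ν * ∫ ζ in Θ₀..θ, κ ^ m ζ)) := by
  have hκ := hm.kappa_pos
  have hlog : Real.log κ < 0 := Real.log_neg hκ hm.kappa_lt_one
  -- The first bound makes `exp (-(R / c₀)) ≥ κ`, so that `α = (μ + 1) / c₀` gives `exp (-(α R)) ≥ κ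
  -- ^ (μ + 1)`; the second is the curvature condition. The spare factor `κ` goes into `ν`.
  set R := min (c₀ * -Real.log κ) (rlim * (1 - Real.cos 1) / 2) with hR
  have hR0 : 0 < R := by
    have h1 := mul_pos h.rlim_pos one_sub_cos_one_pos
    have h2 : 0 < -Real.log κ := by linarith
    exact lt_min (by positivity) (by positivity)
  have hR1 : R / c₀ ≤ -Real.log κ := by
    rw [div_le_iff₀ hc₀, mul_comm]
    exact min_le_left _ _
  have hR2 : 2 * R ≤ rlim * (1 - Real.cos 1) := by
    have : R ≤ rlim * (1 - Real.cos 1) / 2 := min_le_right _ _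
    linarith
  obtain ⟨T, hT, hr⟩ := h.exists_forall_right_le hR0 Θ
  have hT' : θ₀ ≤ T := hm.le_start.trans hT
  set ν := κ * (1 - Real.exp (-(R / c₀))) with hν
  have hE1 : Real.exp (-(R / c₀)) < 1 := Real.exp_lt_one_iff.2 (neg_lt_zero.2 (by positivity))
  have hν0 : 0 < ν := mul_pos hκ (sub_pos.2 hE1)
  have hν1 : ν ≤ 1 := by
    have := Real.exp_pos (-(R / c₀))
    have := hm.kappa_lt_one
    rw [hν]
    nlinarith
  have hpow0 : ∀ ζ, 0 < κ ^ m ζ := fun ζ => Real.rpow_pos_of_pos hκ _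
  -- the contraction factor of one window, in terms of the drift bound there
  have hfactor : ∀ μ : ℝ, 0 ≤ μ → ν * κ ^ μ
      ≤ Real.exp (-((μ + 1) / c₀ * R)) * (1 - Real.exp (-((μ + 1) / c₀ * R))) := by
    intro μ hμ
    have e1 : κ ^ (μ + 1) ≤ Real.exp (-((μ + 1) / c₀ * R)) := by
      rw [Real.rpow_def_of_pos hκ]
      refine Real.exp_le_exp.2 ?_
      have := mul_le_mul_of_nonneg_left hR1 (by linarith : 0 ≤ μ + 1)
      have e : (μ + 1) / c₀ * R = (μ + 1) * (R / c₀) := by ring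
      rw [e]
      linarith
    have e2 : Real.exp (-((μ + 1) / c₀ * R)) ≤ Real.exp (-(R / c₀)) := by
      refine Real.exp_le_exp.2 ?_
      have e : (μ + 1) / c₀ * R = μ * (R / c₀) + R / c₀ := by ring
      have : 0 ≤ μ * (R / c₀) := by positivity
      linarith
    calc ν * κ ^ μ = κ ^ (μ + 1) * (1 - Real.exp (-(R / c₀))) := by
          rw [Real.rpow_add hκ, Real.rpow_one, hν]
          ring
      _ ≤ _ := mul_le_mul e1 (by linarith) (by linarith) (Real.exp_pos _).le
  -- The window from `T + n` to `T + n + 2` has its drift bounded by `m` at its right end, which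
  -- shifts the sampling points of `κ ^ m` by `2`.
  refine ⟨T + 2, ν, by linarith, hν0, ?_⟩
  rintro M₁ A b w hA hb hw ⟨D, hD⟩ θ hθ
  set M : ℝ → ℝ := fun θ => supAbs w (crossSec r₁ r₂ θ) with hM
  have hM0 : ∀ θ, 0 ≤ M θ := fun θ => supAbs_nonneg _ _
  have hmT : ∀ ζ, T ≤ ζ → 0 ≤ m ζ := fun ζ hζ => hm.nonneg ζ (hT.trans hζ)
  have hsumeq : ∀ n N : ℕ, ∑ j ∈ Finset.range n, ν * κ ^ m (T + 2 + (N + j : ℕ))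
      = ν * ∑ j ∈ Finset.range n, κ ^ m (T + 2 + N + j) := by
    intro n N
    rw [Finset.mul_sum]
    refine Finset.sum_congr rfl fun j _ => ?_
    push_cast
    rw [add_assoc (T + 2)]
  have hdivN : ∀ N : ℕ, Tendsto
      (fun n => ∑ j ∈ Finset.range n, ν * κ ^ m (T + 2 + (N + j : ℕ))) atTop atTop := by
    intro N
    have hN : (0 : ℝ) ≤ N := N.cast_nonneg
    simp only [hsumeq]
    exact (hm.tendsto_sum (by linarith)).const_mul_atTop hν0
  have key := antitone_and_decay (M := M) (d := fun n : ℕ => ν * κ ^ m (T + 2 + n)) hT' hM0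
    (fun s θ t hs h1 h2 => by
      obtain ⟨B, hB⟩ := hb.bounded hm hs t
      exact hw.supAbs_le_max h hA hc₀ hs h1 h2 hB)
    (fun n => mul_pos hν0 (hpow0 _))
    (fun n => mul_le_one₀ hν1 (hpow0 _).le (Real.rpow_le_one hκ.le hm.kappa_lt_one.le
      (hmT _ (by have : (0 : ℝ) ≤ n := n.cast_nonneg; linarith))))
    (fun n => by
      have hn : (0 : ℝ) ≤ n := n.cast_nonneg
      set μ := m (T + 2 + n) with hμdef
      have hμ : 0 ≤ μ := hmT _ (by linarith)
      have hB : ∀ x ∈ portion r₁ r₂ (Set.Ioo (T + n + 1 - 1) (T + n + 1 + 1)), ‖b x‖ ≤ μ := by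
        intro x hx
        have hU := portion_subset_domU (θ₀ := θ₀)
          (fun θ hθ => by have := hθ.1; simp only [Set.mem_Ioi]; linarith) hx
        obtain ⟨θ, r, hθ, h1, h2, rfl⟩ := hx
        have hθ1 : Θ ≤ θ := by linarith [hθ.1]
        refine (hb.le_rate θ hθ1 _ ⟨hU, r, h1.le, h2.le, rfl⟩).trans (hm.mono hθ1 ?_ ?_)
        · simp only [Set.mem_Ici]
          linarith
        · linarith [hθ.2]
      have hw' := hw.supAbs_le_mul_max h hA hc₀ (a := T + n + 1) (α := (μ + 1) / c₀) (by linarith)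
        hB (by positivity) (by rw [div_mul_cancel₀ _ hc₀.ne']; linarith) hR0.le hR2
        (fun θ hθ => hr θ (by linarith))
      rw [show T + n + 1 - 1 = T + (n : ℝ) by ring,
        show T + n + 1 + 1 = T + (n : ℝ) + 2 by ring] at hw'
      refine hw'.trans (mul_le_mul_of_nonneg_right ?_ ((hM0 _).trans (le_max_left _ _)))
      linarith [hfactor μ hμ])
    (by simpa using hdivN 0)
    (by
      intro c hc N
      -- A bounded `w` cannot keep pace with the exponential of a divergent sum.
      obtain ⟨k, hk⟩ := ((Real.tendsto_exp_atTop.comp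
        (hdivN N)).eventually_gt_atTop (D / c)).exists
      refine ⟨k, lt_of_le_of_lt (supAbs_le (K := D) ?_ ?_) ((div_lt_iff₀' hc).1 hk)⟩
      · exact (abs_nonneg _).trans (hD (polar (r₁ θ₀) θ₀)
          ⟨θ₀, _, le_rfl, le_rfl, (h.lt _ le_rfl).le, rfl⟩)
      · intro x hx
        refine hD x (crossSec_subset_domUt ?_ hx)
        have : (0 : ℝ) ≤ N := N.cast_nonneg
        have : (0 : ℝ) ≤ k := k.cast_nonneg
        linarith)
  obtain ⟨hanti, hdec⟩ := key
  rw [mul_min_of_nonneg _ _ (hM0 θ₀), mul_one]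
  have h1 : M θ ≤ M θ₀ := hanti θ₀ θ le_rfl hθ
  refine le_min h1 ?_
  rcases le_total (T + 2) θ with hTθ | hTθ
  · have hf := Nat.floor_le (by linarith : 0 ≤ θ - T)
    have hf' := Nat.lt_floor_add_one (θ - T)
    set n := ⌊θ - T⌋₊
    refine (hdec n θ (by linarith)).trans
      (mul_le_mul_of_nonneg_left (Real.exp_le_exp.2 ?_) (hM0 _))
    have hs : ∑ j ∈ Finset.range n, ν * κ ^ m (T + 2 + j)
        = ν * ∑ j ∈ Finset.range n, κ ^ m (T + 2 + j) := by rw [Finset.mul_sum]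
    -- Here `θ < T + n + 1`, so the integral up to `T + 2 + n` covers the one up to `θ` and is
    -- bounded by the left Riemann sum.
    have hint : ∫ ζ in (T + 2)..θ, κ ^ m ζ ≤ ∫ ζ in (T + 2)..(T + 2 + n), κ ^ m ζ := by
      refine intervalIntegral.integral_mono_interval le_rfl hTθ (by linarith) ?_
        (hm.intervalIntegrable (by linarith) (by linarith))
      exact Eventually.of_forall fun ζ => (hpow0 ζ).le
    have := hm.integral_le_sum (s := T + 2) (by linarith) n
    rw [hs, neg_mul]
    exact neg_le_neg (mul_le_mul_of_nonneg_left (hint.trans this) hν0.le)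
  -- To the left of `T + 2` the oriented integral is nonpositive whatever `m` is below `Θ`, so the
  -- exponential is at least `1`.
  · refine h1.trans (le_mul_of_one_le_right (hM0 _) (Real.one_le_exp ?_))
    rw [intervalIntegral.integral_symm]
    have : 0 ≤ ∫ ζ in θ..(T + 2), κ ^ m ζ :=
      intervalIntegral.integral_nonneg hTθ fun ζ _ => (hpow0 ζ).le
    rw [neg_mul_neg]
    positivity

end Spiral

end

theorem theorem6p1 (θ₀ : ℝ) (r₁ r₂ : ℝ → ℝ) (rlim : ℝ)
    (hdom : Spiral.IsProfile θ₀ r₁ r₂ rlim)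
    (c₀ M₁ : ℝ) (hc₀ : 0 < c₀) (hM₁ : 0 < M₁) :
    (∀ M₂ : ℝ, 0 ≤ M₂ →
      ∃ C ν : ℝ, 0 < C ∧ 0 < ν ∧
        ∀ (A : Spiral.Plane → Matrix (Fin 2) (Fin 2) ℝ) (b : Spiral.Plane → Spiral.Plane),
          Spiral.IsElliptic (Spiral.domU θ₀ r₁ r₂) A c₀ M₁ →
          (∀ x ∈ Spiral.domU θ₀ r₁ r₂, ‖b x‖ ≤ M₂) →
          ∀ u₁ u₂ : Spiral.Plane → ℝ,
            Spiral.IsRegular θ₀ r₁ r₂ u₁ → Spiral.IsRegular θ₀ r₁ r₂ u₂ →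
            (∀ x ∈ Spiral.domU θ₀ r₁ r₂, Spiral.opL A b u₁ x = Spiral.opL A b u₂ x) →
            (∀ x ∈ Spiral.lateral θ₀ r₁ r₂, u₁ x = u₂ x) →
            Spiral.BelowExpGrowth θ₀ r₁ r₂ u₁ → Spiral.BelowExpGrowth θ₀ r₁ r₂ u₂ →
            BddAbove ((fun x => |(u₁ - u₂) x|) '' Spiral.domU θ₀ r₁ r₂) ∧
            Spiral.supAbs (u₁ - u₂) (Spiral.domU θ₀ r₁ r₂)
              ≤ Spiral.supAbs (u₁ - u₂) (Spiral.crossSec r₁ r₂ θ₀) ∧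
            ∀ θ : ℝ, θ₀ ≤ θ →
              Spiral.supAbs (u₁ - u₂) (Spiral.crossSec r₁ r₂ θ)
                ≤ C * Spiral.supAbs (u₁ - u₂) (Spiral.crossSec r₁ r₂ θ₀)
                    * Real.exp (-ν * (θ - θ₀)))
    ∧
    (∀ (Θ : ℝ) (m : ℝ → ℝ) (κ : ℝ), Spiral.IsRate θ₀ Θ m κ →
      ∃ Θ₀ ν : ℝ, Θ ≤ Θ₀ ∧ 0 < ν ∧
        ∀ (A : Spiral.Plane → Matrix (Fin 2) (Fin 2) ℝ) (b : Spiral.Plane → Spiral.Plane),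
          Spiral.IsElliptic (Spiral.domU θ₀ r₁ r₂) A c₀ M₁ →
          Spiral.DriftLe θ₀ r₁ r₂ Θ m b →
          ∀ u₁ u₂ : Spiral.Plane → ℝ,
            Spiral.IsRegular θ₀ r₁ r₂ u₁ → Spiral.IsRegular θ₀ r₁ r₂ u₂ →
            (∀ x ∈ Spiral.domU θ₀ r₁ r₂, Spiral.opL A b u₁ x = Spiral.opL A b u₂ x) →
            (∀ x ∈ Spiral.lateral θ₀ r₁ r₂, u₁ x = u₂ x) →
            (∃ B : ℝ, ∀ x ∈ Spiral.domUt θ₀ r₁ r₂, |u₁ x| ≤ B) →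
            (∃ B : ℝ, ∀ x ∈ Spiral.domUt θ₀ r₁ r₂, |u₂ x| ≤ B) →
            ∀ θ : ℝ, θ₀ ≤ θ →
              Spiral.supAbs (u₁ - u₂) (Spiral.crossSec r₁ r₂ θ)
                ≤ Spiral.supAbs (u₁ - u₂) (Spiral.crossSec r₁ r₂ θ₀)
                    * min 1 (Real.exp (-ν * ∫ ζ in Θ₀..θ, κ ^ m ζ))) := by
  refine ⟨fun M₂ hM₂ => ?_, fun Θ m κ hm => ?_⟩
  · obtain ⟨C, ν, hC, hν, H⟩ := Spiral.bounded_drift_decay hdom hc₀ hM₂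
    refine ⟨C, ν, hC, hν, fun A b hA hb u₁ u₂ h₁ h₂ hL hl hg₁ hg₂ => ?_⟩
    have hw := Spiral.isNullSolution_sub hdom h₁ h₂ hL hl
    obtain ⟨hmax, hdec⟩ := H M₁ A b _ hA hb hw
      fun ε hε => Spiral.BelowExpGrowth.sub hdom h₁.2 h₂.2 hg₁ hg₂ hε
    have hbd : ∀ x ∈ Spiral.domU θ₀ r₁ r₂,
        |(u₁ - u₂) x| ≤ Spiral.supAbs (u₁ - u₂) (Spiral.crossSec r₁ r₂ θ₀) := by
      rintro x ⟨θ, r, hθ, hr₁, hr₂, rfl⟩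
      exact (Spiral.abs_le_supAbs hdom hw.continuousOn hθ.le
        ⟨r, hr₁.le, hr₂.le, rfl⟩).trans (hmax θ hθ.le)
    refine ⟨⟨Spiral.supAbs (u₁ - u₂) (Spiral.crossSec r₁ r₂ θ₀), ?_⟩,
      Spiral.supAbs_le (Spiral.supAbs_nonneg _ _) hbd, hdec⟩
    rintro _ ⟨x, hx, rfl⟩
    exact hbd x hx
  · obtain ⟨Θ₀, ν, hΘ₀, hν, H⟩ := Spiral.unbounded_drift_decay hdom hc₀ hm
    refine ⟨Θ₀, ν, hΘ₀, hν, fun A b hA hb u₁ u₂ h₁ h₂ hL hl ⟨B₁, hB₁⟩ ⟨B₂, hB₂⟩ => ?_⟩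
    exact H M₁ A b _ hA hb (Spiral.isNullSolution_sub hdom h₁ h₂ hL hl)
      ⟨B₁ + B₂, fun x hx => (abs_sub _ _).trans (add_le_add (hB₁ x hx) (hB₂ x hx))⟩
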